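/- Let $\Omega\subseteq\mathbb{C}$ be an open set and let $F\subseteq\mathbb{N}_0=\{0,1,2,\dots\}$ be non-empty. Let $\mathcal{A}_F(\Omega)$ be the complex vector space of all holomorphic functions $f:\Omega\to\mathbb{C}$ such that, for every $l\in F$, the derivative $f^{(l)}$ has a continuous extension to the closure $\overline{\Omega}$ of $\Omega$ in $\mathbb{C}$ (this extension is unique and is again denoted by $f^{(l)}$). Fix a point $z_i$ in each connected component $\Omega_i$ ($i\in I$) of $\Omega$, and endow $\mathcal{A}_F(\Omega)$ with the topology induced by the seminorms $$\sup_{z\in\overline{\Omega},\ |z|\le n}\bigl|f^{(l)}(z)\bigr|\quad(l\in F,\ n\in\mathbb{N}_0)\qquad\text{and}\qquad \bigl|f^{(l)}(z_i)\bigr|\quad(0\le l<\min F,\ i\in I),$$ where a supremum over the empty set is $0$. A holomorphic function $f:\Omega\to\mathbb{C}$ is called extendable if there exist open discs $D_1,D_2\subseteq\mathbb{C}$ of positive finite radii such that $D_2\cap\Omega\ne\varnothing$, $D_2\cap(\mathbb{C}\setminus\Omega)\neq\varnothing$ and $\overline{D_1}\subseteq D_2\cap\Omega$, and a holomorphic function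 $G:D_2\to\mathbb{C}$ such that $G=f$ on $D_1$; otherwise $f$ is called non-extendable. Then, for every choice of the points $z_i$, the set of all non-extendable functions in $\mathcal{A}_F(\Omega)$ is either empty, or a dense $G_\delta$ subset of $\mathcal{A}_F(\Omega)$. -/

import Mathlib

open TopologicalSpace

noncomputable section

namespace NonExt

/-- Extension by zero of a function on the open set `Ω` to the whole plane. -/
def extZero {Ω : Opens ℂ} (f : Ω → ℂ) : ℂ → ℂ :=
  Function.extend (Subtype.val : Ω → ℂ) f 0

theorem extZero_coe {Ω : Opens ℂ} (f : Ω → ℂ) (z : Ω) : extZero f z = f z :=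
  Subtype.val_injective.extend_apply f 0 z

theorem extZero_of_mem {Ω : Opens ℂ} (f : Ω → ℂ) {z : ℂ} (hz : z ∈ Ω) :
    extZero f z = f ⟨z, hz⟩ :=
  extZero_coe f ⟨z, hz⟩

/-- The space `H(Ω)` of holomorphic functions `f : Ω → ℂ`. Since `Ω` is open, the values of
`extZero f` off `Ω` play no role in differentiability at the points of `Ω`. -/
def Hol (Ω : Opens ℂ) : Submodule ℂ (Ω → ℂ) where
  carrier := {f | DifferentiableOn ℂ (extZero f) (Ω : Set ℂ)}
  add_mem' {f g} hf hg := by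
    refine (DifferentiableOn.add hf hg).congr fun z hz => ?_
    have hz' : z ∈ Ω := hz
    simp [extZero_of_mem _ hz']
  zero_mem' := by
    refine (differentiableOn_const (0 : ℂ)).congr fun z hz => ?_
    have hz' : z ∈ Ω := hz
    simp [extZero_of_mem _ hz']
  smul_mem' c f hf := by
    refine (DifferentiableOn.const_smul hf c).congr fun z hz => ?_
    have hz' : z ∈ Ω := hz
    simp [extZero_of_mem _ hz']

theorem Hol_differentiableAt {Ω : Opens ℂ} (f : Hol Ω) (z : Ω) :
    DifferentiableAt ℂ (extZero (f : Ω → ℂ)) z :=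
  DifferentiableOn.differentiableAt f.2 (Ω.isOpen.mem_nhds z.2)

/-- Complex differentiation `f ↦ f'` as a linear operator on `H(Ω)`. -/
def D (Ω : Opens ℂ) : Hol Ω →ₗ[ℂ] Hol Ω where
  toFun f := ⟨fun z => deriv (extZero (f : Ω → ℂ)) z, by
    refine (DifferentiableOn.deriv f.2 Ω.isOpen).congr fun z hz => ?_
    have hz' : z ∈ Ω := hz
    rw [extZero_of_mem _ hz']⟩
  map_add' f g := by
    ext z
    have h : extZero ((f + g : Hol Ω) : Ω → ℂ) =ᶠ[nhds (z : ℂ)]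
        extZero (f : Ω → ℂ) + extZero (g : Ω → ℂ) := by
      filter_upwards [Ω.isOpen.mem_nhds z.2] with w hw
      have hw' : w ∈ Ω := hw
      simp [extZero_of_mem _ hw']
    simpa using h.deriv_eq.trans (deriv_add (Hol_differentiableAt f z) (Hol_differentiableAt g z))
  map_smul' c f := by
    ext z
    have h : extZero ((c • f : Hol Ω) : Ω → ℂ) =ᶠ[nhds (z : ℂ)]
        c • extZero (f : Ω → ℂ) := by
      filter_upwards [Ω.isOpen.mem_nhds z.2] with w hw
      have hw' : w ∈ Ω := hw
      simp [extZero_of_mem _ hw']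
    simpa using h.deriv_eq.trans (deriv_const_smul c (Hol_differentiableAt f z))

/-- The inclusion of `Ω` into its closure (in `ℂ`). -/
def toClosure {Ω : Opens ℂ} (z : Ω) : closure (Ω : Set ℂ) := ⟨z, subset_closure z.2⟩

theorem denseRange_toClosure (Ω : Opens ℂ) : DenseRange (toClosure (Ω := Ω)) := by
  intro x
  rw [closure_subtype]
  have h : (Subtype.val '' Set.range (toClosure (Ω := Ω)) : Set ℂ) = Ω := by
    ext z
    simpa [toClosure] using fun hz : z ∈ Ω => subset_closure (s := (Ω : Set ℂ)) hz
  rw [h]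
  exact x.2

/-- The space `𝒜(Ω)` of holomorphic functions on `Ω` that have a continuous extension to the
closure of `Ω` in `ℂ`. -/
def A (Ω : Opens ℂ) : Submodule ℂ (Hol Ω) where
  carrier := {f | ∃ g : C(closure (Ω : Set ℂ), ℂ), ∀ z : Ω, g (toClosure z) = (f : Ω → ℂ) z}
  add_mem' := by
    rintro f₁ f₂ ⟨g₁, h₁⟩ ⟨g₂, h₂⟩
    exact ⟨g₁ + g₂, fun z => by simp [h₁, h₂]⟩
  zero_mem' := ⟨0, fun z => by simp⟩
  smul_mem' := by
    rintro c f ⟨g, h⟩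
    exact ⟨c • g, fun z => by simp [h]⟩

theorem ext_unique {Ω : Opens ℂ} {g₁ g₂ : C(closure (Ω : Set ℂ), ℂ)}
    (h : ∀ z : Ω, g₁ (toClosure z) = g₂ (toClosure z)) : g₁ = g₂ :=
  DFunLike.coe_injective <|
    (denseRange_toClosure Ω).equalizer g₁.continuous g₂.continuous (funext h)

/-- The (unique) continuous extension of `f ∈ 𝒜(Ω)` to the closure of `Ω`. -/
def clExt {Ω : Opens ℂ} (f : A Ω) : C(closure (Ω : Set ℂ), ℂ) := f.2.choose

theorem clExt_spec {Ω : Opens ℂ} (f : A Ω) (z : Ω) :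
    clExt f (toClosure z) = ((f : Hol Ω) : Ω → ℂ) z :=
  f.2.choose_spec z

theorem clExt_add {Ω : Opens ℂ} (f g : A Ω) : clExt (f + g) = clExt f + clExt g :=
  ext_unique fun z => by simp [clExt_spec]

theorem clExt_smul {Ω : Opens ℂ} (c : ℂ) (f : A Ω) : clExt (c • f) = c • clExt f :=
  ext_unique fun z => by simp [clExt_spec]

theorem bddAbove_ball {Ω : Opens ℂ} (g : C(closure (Ω : Set ℂ), ℂ)) (n : ℕ) :
    BddAbove (Set.range fun z : {z : closure (Ω : Set ℂ) // ‖(z : ℂ)‖ ≤ n} => ‖g z‖) := by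
  have hc : IsCompact {z : closure (Ω : Set ℂ) | ‖(z : ℂ)‖ ≤ n} := by
    have h := (isClosed_closure (s := (Ω : Set ℂ))).isClosedEmbedding_subtypeVal.isCompact_preimage
      (isCompact_closedBall (0 : ℂ) n)
    convert h using 1
    ext z
    simp
  have h := hc.bddAbove_image (f := fun z => ‖g z‖) (by fun_prop)
  rwa [Set.image_eq_range] at h

/-- The seminorm `sup {|f z| : z ∈ closure Ω, |z| ≤ n}` on `𝒜(Ω)`, where `f` is continuously
extended to the closure of `Ω`. The supremum over the empty set is `0`. -/
def supSeminorm (Ω : Opens ℂ) (n : ℕ) : Seminorm ℂ (A Ω) :=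
  Seminorm.of (fun f => ⨆ z : {z : closure (Ω : Set ℂ) // ‖(z : ℂ)‖ ≤ n}, ‖clExt f z‖)
    (fun f g => by
      refine Real.iSup_le (fun z => ?_) (add_nonneg (Real.iSup_nonneg fun _ => norm_nonneg _)
        (Real.iSup_nonneg fun _ => norm_nonneg _))
      rw [clExt_add]
      exact (norm_add_le _ _).trans
        (add_le_add (le_ciSup (bddAbove_ball (clExt f) n) z)
          (le_ciSup (bddAbove_ball (clExt g) n) z)))
    (fun c f => by
      simp only [clExt_smul, ContinuousMap.smul_apply, norm_smul]
      exact (Real.mul_iSup_of_nonneg (norm_nonneg c) _).symm)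

/-- The space `𝒜_F(Ω)` of all `f ∈ H(Ω)` such that `f^(l) ∈ 𝒜(Ω)` for all `l ∈ F`. -/
def AF (Ω : Opens ℂ) (F : Set ℕ) : Submodule ℂ (Hol Ω) where
  carrier := {f | ∀ l ∈ F, (D Ω ^ l) f ∈ A Ω}
  add_mem' hf hg l hl := by
    rw [map_add]
    exact (A Ω).add_mem (hf l hl) (hg l hl)
  zero_mem' l _ := by
    rw [map_zero]
    exact (A Ω).zero_mem
  smul_mem' c f hf l hl := by
    rw [map_smul]
    exact (A Ω).smul_mem c (hf l hl)

/-- The linear map `f ↦ f^(l)` from `𝒜_F(Ω)` to `𝒜(Ω)`, for `l ∈ F`. -/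
def derivToA (Ω : Opens ℂ) (F : Set ℕ) (l : F) : AF Ω F →ₗ[ℂ] A Ω :=
  ((D Ω ^ (l : ℕ)) ∘ₗ (AF Ω F).subtype).codRestrict (A Ω) fun f => f.2 l l.2

/-- The linear functional `f ↦ f^(l)(z)` on `𝒜_F(Ω)`, for `z ∈ Ω`. -/
def derivAt (Ω : Opens ℂ) (F : Set ℕ) (l : ℕ) (z : Ω) : AF Ω F →ₗ[ℂ] ℂ :=
  LinearMap.proj z ∘ₗ (Hol Ω).subtype ∘ₗ (D Ω ^ l) ∘ₗ (AF Ω F).subtype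

/-- The seminorms of `𝒜_F(Ω)`, given a point `b c` in every connected component `c` of `Ω`:
`sup {|f^(l) z| : z ∈ closure Ω, |z| ≤ n}` for `l ∈ F`, `n ∈ ℕ`, and
`|f^(l) (b c)|` for `0 ≤ l < min F` and every component `c` of `Ω`. -/
def seminormFamily (Ω : Opens ℂ) (F : Set ℕ) (b : ConnectedComponents Ω → Ω) :
    SeminormFamily ℂ (AF Ω F) ((F × ℕ) ⊕ ({l : ℕ // l < sInf F} × ConnectedComponents Ω))
  | Sum.inl (l, n) => (supSeminorm Ω n).comp (derivToA Ω F l)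
  | Sum.inr (l, c) => (normSeminorm ℂ ℂ).comp (derivAt Ω F l (b c))

/-- The natural topology of `𝒜_F(Ω)`, that is, the one induced by the above seminorms. -/
abbrev naturalTopology (Ω : Opens ℂ) (F : Set ℕ) (b : ConnectedComponents Ω → Ω) :
    TopologicalSpace (AF Ω F) :=
  (seminormFamily Ω F b).moduleFilterBasis.topology

/-- `f ∈ H(Ω)` is extendable (in the sense of Riemann surfaces): there are open discs
`D₁ = ball c₁ r₁` and `D₂ = ball c₂ r₂`, where `D₂` meets both `Ω` and its complement and
`closure D₁ ⊆ D₂ ∩ Ω`, and a holomorphic function on `D₂` that agrees with `f` on `D₁`. -/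
def IsExtendable {Ω : Opens ℂ} (f : Hol Ω) : Prop :=
  ∃ (c₁ c₂ : ℂ) (r₁ r₂ : ℝ), 0 < r₁ ∧ 0 < r₂ ∧
    (Metric.ball c₂ r₂ ∩ (Ω : Set ℂ)).Nonempty ∧
    (Metric.ball c₂ r₂ ∩ (Ω : Set ℂ)ᶜ).Nonempty ∧
    closure (Metric.ball c₁ r₁) ⊆ Metric.ball c₂ r₂ ∩ (Ω : Set ℂ) ∧
    ∃ G : ℂ → ℂ, DifferentiableOn ℂ G (Metric.ball c₂ r₂) ∧
      ∀ z : Ω, (z : ℂ) ∈ Metric.ball c₁ r₁ → G z = (f : Ω → ℂ) z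

/-- The set of non-extendable functions in `𝒜_F(Ω)`. -/
def nonExtendable (Ω : Opens ℂ) (F : Set ℕ) : Set (AF Ω F) :=
  {f | ¬ IsExtendable (f : Hol Ω)}

end NonExt

end

open Metric Filter
open scoped Topology

noncomputable section

namespace NonExt

/-! Let `s` be a countable dense subset of `Ω`. By Cauchy's estimates and convergence of Taylor
series, `f` is extendable iff, for some `w ∈ s` and rational `r > 0` whose disc `ball w r` leaves
`Ω`, the Taylor coefficients of `f` at `w` are `O(r⁻ⁿ)` (`nonExtendable_eq`). For fixed `(w, r)`
such `f` form a linear subspace, so the extendable functions are a countable union of subspaces. One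
non-extendable `e` lies in none of them, and each line `f + ℂe` then meets each subspace at most
once; this gives density without Baire's theorem.

For the `Gδ` part each subspace is a countable union of closed sets, provided every `f ↦ f^(n)(w)`
is continuous (`continuous_derivAt`). The seminorms control `f^(m)`, `m = min F`, locally. Cauchy's
estimate passes this on to higher orders; the mean value inequality and connectedness carry it to
lower orders from the base points. -/

/-- Countably many subspaces that all miss a common vector have a dense complement. -/
theorem dense_compl_iUnion_submodule {E ι : Type*} [AddCommGroup E] [Module ℂ E]
    [TopologicalSpace E] [ContinuousAdd E] [ContinuousSMul ℂ E] [Countable ι]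
    (V : ι → Submodule ℂ E) {e : E} (he : ∀ i, e ∉ V i) :
    Dense (⋃ i, (V i : Set E))ᶜ := by
  intro f
  have hcount : (⋃ i, {t : ℂ | f + t • e ∈ V i}).Countable := by
    refine Set.countable_iUnion fun i => Set.Subsingleton.countable fun s hs t ht => ?_
    by_contra hst
    refine he i ?_
    have h : (s - t) • e ∈ V i := by
      have := (V i).sub_mem hs ht
      rwa [add_sub_add_left_eq_sub, ← sub_smul] at this
    exact ((V i).smul_mem_iff (sub_ne_zero.2 hst)).1 h
  have hc : Continuous fun t : ℂ => f + t • e := by fun_prop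
  have h := map_mem_closure hc (hcount.dense_compl ℂ 0)
    (t := (⋃ i, (V i : Set E))ᶜ) fun t ht => by simpa using ht
  simpa using h

/-! ### Iterated derivatives on `Ω` -/

section Derivatives

variable {Ω : Opens ℂ}

theorem differentiableOn_extZero (f : Hol Ω) :
    DifferentiableOn ℂ (extZero (f : Ω → ℂ)) (Ω : Set ℂ) := f.2

theorem extZero_D_pow_succ (f : Hol Ω) (n : ℕ) {z : ℂ} (hz : z ∈ Ω) :
    extZero ((D Ω ^ (n + 1)) f : Ω → ℂ) z = deriv (extZero ((D Ω ^ n) f : Ω → ℂ)) z := by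
  rw [extZero_of_mem _ hz, pow_succ']
  rfl

theorem extZero_D_pow (f : Hol Ω) (n : ℕ) {z : ℂ} (hz : z ∈ Ω) :
    extZero ((D Ω ^ n) f : Ω → ℂ) z = iteratedDeriv n (extZero (f : Ω → ℂ)) z := by
  induction n generalizing z with
  | zero => simp
  | succ n ih =>
    rw [extZero_D_pow_succ f n hz, iteratedDeriv_succ]
    refine EventuallyEq.deriv_eq ?_
    filter_upwards [Ω.isOpen.mem_nhds hz] with w hw using ih hw

theorem analyticAt_extZero (f : Hol Ω) {z : ℂ} (hz : z ∈ Ω) :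
    AnalyticAt ℂ (extZero (f : Ω → ℂ)) z :=
  (differentiableOn_extZero f).analyticAt (Ω.isOpen.mem_nhds hz)

end Derivatives

/-! ### Extendability and growth of Taylor coefficients -/

section Extension

variable {Ω : Opens ℂ}

/-- The Taylor coefficients `f^(n)(w) / n!` of `f` at `w` are `O(r⁻ⁿ)`. -/
def TaylorBounded (f : Hol Ω) (w : Ω) (r : ℝ) : Prop :=
  ∃ M : ℕ, ∀ n : ℕ, ‖((D Ω ^ n) f : Ω → ℂ) w‖ * r ^ n ≤ M * n.factorial

theorem isExtendable_of_taylorBounded {f : Hol Ω} {w : Ω} {r : ℝ} (hr : 0 < r)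
    (hΩ : (ball (w : ℂ) r ∩ (Ω : Set ℂ)ᶜ).Nonempty) (h : TaylorBounded f w r) :
    IsExtendable f := by
  obtain ⟨M, hM⟩ := h
  set F : ℂ → ℂ := extZero (f : Ω → ℂ) with hF
  set p := FormalMultilinearSeries.ofScalars ℂ
    (fun n => iteratedDeriv n F w / n.factorial) with hp
  have hps : HasFPowerSeriesAt F p w := (analyticAt_extZero f w.2).hasFPowerSeriesAt
  have hrad : ENNReal.ofReal r ≤ p.radius := by
    refine p.le_radius_of_bound M fun n => ?_
    rw [hp, FormalMultilinearSeries.ofScalars_norm, ← extZero_D_pow f n w.2,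
      extZero_coe, Real.coe_toNNReal r hr.le, norm_div, div_mul_eq_mul_div]
    have hn : (0 : ℝ) < n.factorial := by positivity
    simpa [div_le_iff₀ hn] using hM n
  have hball : HasFPowerSeriesOnBall (fun z => p.sum (z - w)) p (0 + w) p.radius :=
    (p.hasFPowerSeriesOnBall ((ENNReal.ofReal_pos.2 hr).trans_le hrad)).comp_sub w
  rw [zero_add] at hball
  have heq : ∀ᶠ z in 𝓝 (w : ℂ), p.sum (z - w) = F z := by
    obtain ⟨ρ, hρ⟩ := hps
    filter_upwards [eball_mem_nhds (w : ℂ) hρ.r_pos] with z hz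
    have := hρ.sum (y := z - w) (by simpa [edist_eq_enorm_sub] using hz)
    rw [← this, add_sub_cancel]
  obtain ⟨s, hs, hsub⟩ := Metric.nhds_basis_closedBall.mem_iff.1
    (inter_mem heq (inter_mem (ball_mem_nhds (w : ℂ) hr) (Ω.isOpen.mem_nhds w.2)))
  refine ⟨w, w, s, r, hs, hr, ⟨w, mem_ball_self hr, w.2⟩, hΩ,
    closure_ball_subset_closedBall.trans fun z hz => (hsub hz).2,
    fun z => p.sum (z - w), ?_, fun z hz => ?_⟩
  · refine hball.differentiableOn.mono ?_
    rw [← eball_ofReal]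
    exact eball_subset_eball hrad
  · rw [← extZero_coe (f : Ω → ℂ)]
    exact (hsub (ball_subset_closedBall hz)).1

/-- `G` need only agree with `f` on the component of `D₂ ∩ Ω` containing `D₁`. The new disc is
therefore centred in that component, close to a point where a segment in `D₂` first leaves `Ω`. -/
theorem exists_taylorBounded_of_isExtendable {f : Hol Ω} {s : Set Ω} (hs : Dense s)
    (h : IsExtendable f) :
    ∃ w ∈ s, ∃ r : ℚ, 0 < (r : ℝ) ∧ (ball (w : ℂ) r ∩ (Ω : Set ℂ)ᶜ).Nonempty ∧
      TaylorBounded f w r := by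
  obtain ⟨c₁, c₂, r₁, r₂, hr₁, hr₂, -, ⟨ζ₀, hζ₀, hζ₀Ω⟩, hsub, G, hG, hGf⟩ := h
  have hc₁ : c₁ ∈ ball c₂ r₂ ∩ (Ω : Set ℂ) := hsub (subset_closure (mem_ball_self hr₁))
  set F : ℂ → ℂ := extZero (f : Ω → ℂ) with hF
  have hFG : F =ᶠ[𝓝 c₁] G := by
    filter_upwards [ball_mem_nhds c₁ hr₁] with z hz
    have hzΩ : z ∈ Ω := (hsub (subset_closure hz)).2
    rw [hF, extZero_of_mem _ hzΩ]
    exact (hGf ⟨z, hzΩ⟩ hz).symm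
  -- the first point outside `Ω` on the segment from `c₁` to `ζ₀`
  set γ : ℝ → ℂ := fun t => AffineMap.lineMap c₁ ζ₀ t with hγ
  have hγc : Continuous γ := AffineMap.lineMap_continuous
  set T : Set ℝ := Set.Icc 0 1 ∩ γ ⁻¹' (Ω : Set ℂ)ᶜ with hT
  have hTcl : IsClosed T := isClosed_Icc.inter (Ω.isOpen.isClosed_compl.preimage hγc)
  have hTne : T.Nonempty := ⟨1, by simp, by simpa [hγ] using hζ₀Ω⟩
  have hTbd : BddBelow T := ⟨0, fun t ht => ht.1.1⟩
  set t₀ := sInf T with ht₀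
  have ht₀T : t₀ ∈ T := hTcl.csInf_mem hTne hTbd
  have ht₀pos : 0 < t₀ := by
    refine lt_of_le_of_ne ht₀T.1.1 fun h0 => ht₀T.2 ?_
    rw [← h0]
    simpa [hγ] using hc₁.2
  have hγD : ∀ t ∈ Set.Icc (0 : ℝ) 1, γ t ∈ ball c₂ r₂ := fun t ht =>
    (convex_ball c₂ r₂).lineMap_mem hc₁.1 hζ₀ ht
  have hγΩ : ∀ t, 0 ≤ t → t < t₀ → γ t ∈ Ω := fun t h0 ht => by
    by_contra hn
    exact absurd (csInf_le hTbd (show t ∈ T from ⟨⟨h0, ht.le.trans ht₀T.1.2⟩, hn⟩)) (not_le.2 ht)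
  -- Identity theorem on the component of `D₂ ∩ Ω` containing `c₁`.
  have hEq : ∀ t, 0 ≤ t → t < t₀ → F =ᶠ[𝓝 (γ t)] G := fun t h0 ht => by
    set U : Set ℂ := ball c₂ r₂ ∩ Ω with hU
    have hUo : IsOpen U := isOpen_ball.inter Ω.isOpen
    have hmem : ∀ u ∈ Set.Icc 0 t, γ u ∈ U := fun u hu =>
      ⟨hγD u ⟨hu.1, hu.2.trans (ht.le.trans ht₀T.1.2)⟩, hγΩ u hu.1 (hu.2.trans_lt ht)⟩
    have hpre : IsPreconnected (γ '' Set.Icc 0 t) :=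
      isPreconnected_Icc.image γ hγc.continuousOn
    have hsubset : γ '' Set.Icc 0 t ⊆ connectedComponentIn U c₁ := by
      refine hpre.subset_connectedComponentIn ⟨0, ⟨le_rfl, h0⟩, by simp [hγ]⟩ ?_
      rintro _ ⟨u, hu, rfl⟩
      exact hmem u hu
    have hFa : AnalyticOnNhd ℂ F (connectedComponentIn U c₁) := fun z hz =>
      analyticAt_extZero f (connectedComponentIn_subset U c₁ hz).2
    have hGa : AnalyticOnNhd ℂ G (connectedComponentIn U c₁) := fun z hz =>
      hG.analyticAt (isOpen_ball.mem_nhds (connectedComponentIn_subset U c₁ hz).1)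
    have := hFa.eqOn_of_preconnected_of_eventuallyEq hGa isPreconnected_connectedComponentIn
      (mem_connectedComponentIn hc₁) hFG
    exact this.eventuallyEq_of_mem
      (hUo.connectedComponentIn.mem_nhds (hsubset ⟨t, ⟨h0, le_rfl⟩, rfl⟩))
  obtain ⟨ε, hε, hεsub⟩ := Metric.isOpen_iff.1 isOpen_ball (γ t₀) (hγD t₀ ht₀T.1)
  -- With `r < ε / 2`, any `w` within `r` of `γ t₀` has `closedBall w r` inside `ball (γ t₀) ε ⊆
  -- D₂`, while `ball w r` contains `γ t₀ ∉ Ω`.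
  obtain ⟨r, hr0, hrε⟩ := exists_rat_btwn (half_pos hε)
  obtain ⟨t, ht0, htt, htr⟩ : ∃ t, 0 ≤ t ∧ t < t₀ ∧ γ t ∈ ball (γ t₀) r := by
    have h1 : ∀ᶠ t in 𝓝[<] t₀, γ t ∈ ball (γ t₀) r :=
      (hγc.continuousAt.eventually (ball_mem_nhds _ hr0)).filter_mono nhdsWithin_le_nhds
    have h2 : ∀ᶠ t in 𝓝[<] t₀, t ∈ Set.Ioo 0 t₀ := Ioo_mem_nhdsLT ht₀pos
    obtain ⟨t, h, h'⟩ := (h1.and h2).exists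
    exact ⟨t, h'.1.le, h'.2, h⟩
  have hnhds : ∀ᶠ w in 𝓝 (γ t), F =ᶠ[𝓝 w] G ∧ w ∈ ball (γ t₀) r :=
    (hEq t ht0 htt).eventuallyEq_nhds.and (isOpen_ball.mem_nhds htr)
  obtain ⟨w, hws, hw, hwr⟩ : ∃ w ∈ s, F =ᶠ[𝓝 (w : ℂ)] G ∧ (w : ℂ) ∈ ball (γ t₀) r := by
    have := (continuous_subtype_val (p := (· ∈ Ω))).continuousAt.eventually
      (show ∀ᶠ w in 𝓝 ((⟨γ t, hγΩ t ht0 htt⟩ : Ω) : ℂ), _ from hnhds)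
    obtain ⟨w, h, hws⟩ := hs.exists_mem_open isOpen_interior
      ⟨_, mem_interior_iff_mem_nhds.2 this⟩
    have hw := interior_subset hws
    exact ⟨w, h, hw.1, hw.2⟩
  have hcl : closedBall (w : ℂ) r ⊆ ball c₂ r₂ := by
    refine Set.Subset.trans (fun z hz => ?_) hεsub
    rw [mem_ball] at hwr ⊢
    rw [mem_closedBall] at hz
    linarith [dist_triangle z (w : ℂ) (γ t₀)]
  obtain ⟨C, hC⟩ := (isCompact_closedBall (w : ℂ) r).exists_bound_of_continuousOn
    (hG.continuousOn.mono hcl)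
  obtain ⟨M, hM⟩ := exists_nat_ge C
  refine ⟨w, hws, r, hr0, ⟨γ t₀, mem_ball_comm.1 hwr, ht₀T.2⟩, M, fun n => ?_⟩
  have hd : DiffContOnCl ℂ G (ball (w : ℂ) r) :=
    (hG.mono (closure_ball_subset_closedBall.trans hcl)).diffContOnCl
  have hcau := Complex.norm_iteratedDeriv_le_of_forall_mem_sphere_norm_le n hr0 hd
    fun z hz => (hC z (sphere_subset_closedBall hz)).trans hM
  rw [← extZero_coe ((D Ω ^ n) f : Ω → ℂ), extZero_D_pow f n w.2, hw.iteratedDeriv_eq n]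
  rwa [le_div_iff₀ (pow_pos hr0 n), mul_comm (n.factorial : ℝ)] at hcau

end Extension

/-! ### Local control of derivatives of all orders -/

section Control

variable {Ω : Opens ℂ} {E : Type*} [AddCommGroup E] [Module ℂ E] [TopologicalSpace E]

/-- The size of `(j x)^(l)` on the set `s` is controlled by a continuous function of `x` that
vanishes at `0`. -/
def ControlledOn (j : E →ₗ[ℂ] Hol Ω) (l : ℕ) (s : Set ℂ) : Prop :=
  ∃ q : E → ℝ, Continuous q ∧ q 0 = 0 ∧
    ∀ x, ∀ z ∈ s, ‖extZero ((D Ω ^ l) (j x) : Ω → ℂ) z‖ ≤ q x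

/-- The size of `(j x)^(l)` is controlled near `w`. -/
def ControlledAt (j : E →ₗ[ℂ] Hol Ω) (l : ℕ) (w : ℂ) : Prop :=
  ∃ r > 0, ControlledOn j l (ball w r)

variable {j : E →ₗ[ℂ] Hol Ω} {l : ℕ}

theorem ControlledOn.mono {s t : Set ℂ} (h : ControlledOn j l t) (hst : s ⊆ t) :
    ControlledOn j l s := by
  obtain ⟨q, hq, hq0, hb⟩ := h
  exact ⟨q, hq, hq0, fun x z hz => hb x z (hst hz)⟩

theorem ControlledAt.controlledOn_ball_subset {w : ℂ} (h : ControlledAt j l w) (hw : w ∈ Ω) :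
    ∃ r > 0, ball w r ⊆ Ω ∧ ControlledOn j l (ball w r) := by
  obtain ⟨r, hr, h⟩ := h
  obtain ⟨ε, hε, hsub⟩ := Metric.isOpen_iff.1 Ω.isOpen w hw
  exact ⟨min r ε, lt_min hr hε, (ball_subset_ball (min_le_right _ _)).trans hsub,
    h.mono (ball_subset_ball (min_le_left _ _))⟩

/-- Cauchy's estimate on circles of radius `r / 4` about points of `ball w (r / 2)`. -/
theorem ControlledAt.succ {w : ℂ} (h : ControlledAt j l w) (hw : w ∈ Ω) :
    ControlledAt j (l + 1) w := by
  obtain ⟨r, hr, hΩ, q, hq, hq0, hb⟩ := h.controlledOn_ball_subset hw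
  refine ⟨r / 2, half_pos hr, fun x => q x / (r / 4), by fun_prop, by simp [hq0],
    fun x z hz => ?_⟩
  have hsub : closedBall z (r / 4) ⊆ ball w r := fun u hu => by
    rw [mem_closedBall] at hu
    rw [mem_ball] at hz ⊢
    linarith [dist_triangle u z w]
  have hzΩ : z ∈ Ω := hΩ (hsub (mem_closedBall_self (by positivity)))
  rw [extZero_D_pow_succ _ _ hzΩ]
  refine Complex.norm_deriv_le_of_forall_mem_sphere_norm_le (by positivity) ?_
    fun u hu => hb x u (hsub (sphere_subset_closedBall hu))
  exact ((differentiableOn_extZero _).mono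
    (closure_ball_subset_closedBall.trans (hsub.trans hΩ))).diffContOnCl

/-- Mean value inequality on the convex disc `ball w r`. The radius is chosen before `u`, which
makes the controlled set closed in `controlledAt_of_succ`. -/
theorem ControlledAt.of_succ {w : ℂ} (h : ControlledAt j (l + 1) w) (hw : w ∈ Ω) :
    ∃ r > 0, ∀ u ∈ ball w r, ControlledOn j l {u} → ControlledAt j l w := by
  obtain ⟨r, hr, hΩ, q, hq, hq0, hb⟩ := h.controlledOn_ball_subset hw
  refine ⟨r, hr, fun u hu => ?_⟩
  rintro ⟨p, hp, hp0, hpb⟩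
  refine ⟨r, hr, fun x => p x + q x * (2 * r), by fun_prop, by simp [hp0, hq0],
    fun x z hz => ?_⟩
  have hmv := Convex.norm_image_sub_le_of_norm_deriv_le
    (f := extZero ((D Ω ^ l) (j x) : Ω → ℂ)) (C := q x)
    (fun v hv => (analyticAt_extZero _ (hΩ hv)).differentiableAt)
    (fun v hv => by
      rw [← extZero_D_pow_succ _ _ (hΩ hv)]
      exact hb x v hv) (convex_ball w r) hu hz
  have hqx : 0 ≤ q x := (norm_nonneg _).trans (hb x z hz)
  have hzu : ‖z - u‖ ≤ 2 * r := by
    rw [← dist_eq_norm]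
    rw [mem_ball] at hu hz
    linarith [dist_triangle_right z u w]
  have h1 := norm_le_norm_add_norm_sub' (extZero ((D Ω ^ l) (j x) : Ω → ℂ) z)
    (extZero ((D Ω ^ l) (j x) : Ω → ℂ) u)
  linarith [hpb x u rfl, mul_le_mul_of_nonneg_left hzu hqx]

/-- The set of controlled points is clopen in `Ω` and contains every base point, hence every
component. -/
theorem controlledAt_of_succ {b : ConnectedComponents Ω → Ω}
    (hb : ∀ c, ConnectedComponents.mk (b c) = c)
    (hpt : ∀ c, ControlledOn j l {(b c : ℂ)})
    (hsucc : ∀ w : Ω, ControlledAt j (l + 1) (w : ℂ)) (w : Ω) :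
    ControlledAt j l (w : ℂ) := by
  set S : Set Ω := {w | ControlledAt j l (w : ℂ)} with hS
  have hopen : IsOpen S := by
    rw [Metric.isOpen_iff]
    rintro w ⟨r, hr, h⟩
    refine ⟨r / 2, half_pos hr, fun u hu => ⟨r / 2, half_pos hr, h.mono fun z hz => ?_⟩⟩
    rw [mem_ball] at hz hu ⊢
    rw [Subtype.dist_eq] at hu
    linarith [dist_triangle z (u : ℂ) w]
  have hclosed : IsClosed S := by
    refine isClosed_of_closure_subset fun w hw => ?_
    obtain ⟨r, hr, h⟩ := (hsucc w).of_succ w.2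
    obtain ⟨u, ⟨ρ, hρ, hu⟩, hwu⟩ := Metric.mem_closure_iff.1 hw r hr
    exact h u (by rwa [mem_ball, dist_comm])
      (hu.mono (Set.singleton_subset_iff.2 (mem_ball_self hρ)))
  have hbS : b (ConnectedComponents.mk w) ∈ S := by
    obtain ⟨r, hr, h⟩ := (hsucc (b (ConnectedComponents.mk w))).of_succ (b _).2
    exact h _ (mem_ball_self hr) (hpt _)
  refine (IsClopen.connectedComponent_subset ⟨hclosed, hopen⟩ hbS) ?_
  rw [← ConnectedComponents.coe_eq_coe', hb]

theorem controlledAt_of_controlledAt {b : ConnectedComponents Ω → Ω}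
    (hb : ∀ c, ConnectedComponents.mk (b c) = c) {m : ℕ}
    (hpt : ∀ l < m, ∀ c, ControlledOn j l {(b c : ℂ)})
    (hm : ∀ w : Ω, ControlledAt j m (w : ℂ)) (n : ℕ) (w : Ω) :
    ControlledAt j n (w : ℂ) := by
  rcases le_total m n with h | h
  · induction n, h using Nat.le_induction with
    | base => exact hm w
    | succ n _ ih => exact ih.succ w.2
  · induction h using Nat.decreasingInduction generalizing w with
    | self => exact hm w
    | of_succ n hn ih => exact controlledAt_of_succ hb (hpt n hn) ih w

theorem ControlledAt.continuous [IsTopologicalAddGroup E] {w : Ω}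
    (h : ControlledAt j l (w : ℂ)) :
    Continuous fun x => ((D Ω ^ l) (j x) : Ω → ℂ) w := by
  obtain ⟨r, hr, q, hq, hq0, hb⟩ := h
  let φ : E →ₗ[ℂ] ℂ := LinearMap.proj w ∘ₗ (Hol Ω).subtype ∘ₗ (D Ω ^ l) ∘ₗ j
  refine continuous_of_continuousAt_zero φ ?_
  rw [ContinuousAt, map_zero]
  refine squeeze_zero_norm (fun x => ?_) (hq0 ▸ hq.tendsto 0)
  have := hb x w (mem_ball_self hr)
  rwa [extZero_coe] at this

end Control

/-! ### Continuity and closedness in the natural topology -/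

section Natural

variable {Ω : Opens ℂ} {F : Set ℕ}

theorem norm_le_supSeminorm (f : A Ω) {n : ℕ} {z : Ω} (hz : ‖(z : ℂ)‖ ≤ n) :
    ‖((f : Hol Ω) : Ω → ℂ) z‖ ≤ supSeminorm Ω n f := by
  rw [← clExt_spec]
  exact le_ciSup (bddAbove_ball (clExt f) n) ⟨toClosure z, hz⟩

theorem continuous_derivAt (hF : F.Nonempty) {b : ConnectedComponents Ω → Ω}
    (hb : ∀ c, ConnectedComponents.mk (b c) = c) (n : ℕ) (w : Ω) :
    @Continuous (AF Ω F) ℂ (naturalTopology Ω F b) _ (derivAt Ω F n w) := by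
  let _ : TopologicalSpace (AF Ω F) := naturalTopology Ω F b
  have hws : WithSeminorms (seminormFamily Ω F b) := ⟨rfl⟩
  have := hws.topologicalAddGroup
  refine (controlledAt_of_controlledAt (E := AF Ω F) (j := (AF Ω F).subtype) hb (m := sInf F) ?_ ?_
    n w).continuous
  · intro l hl c
    refine ⟨_, hws.continuous_seminorm (Sum.inr (⟨l, hl⟩, c)), map_zero _, ?_⟩
    rintro f _ rfl
    rw [extZero_coe]
    exact le_rfl
  · intro w
    -- The margin `1` keeps `ball w (min 1 ε)` within `‖z‖ ≤ N`.
    obtain ⟨N, hN⟩ := exists_nat_ge (‖(w : ℂ)‖ + 1)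
    obtain ⟨ε, hε, hsub⟩ := Metric.isOpen_iff.1 Ω.isOpen w w.2
    refine ⟨min 1 ε, lt_min one_pos hε, _,
      hws.continuous_seminorm (Sum.inl (⟨sInf F, Nat.sInf_mem hF⟩, N)), map_zero _, ?_⟩
    intro f z hz
    have hzΩ : z ∈ Ω := hsub (ball_subset_ball (min_le_right _ _) hz)
    have hzN : ‖z‖ ≤ N := by
      have h1 : dist z w < 1 := ball_subset_ball (min_le_left _ _) hz
      rw [dist_eq_norm] at h1
      linarith [norm_le_norm_add_norm_sub' z (w : ℂ)]
    rw [extZero_of_mem _ hzΩ]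
    exact norm_le_supSeminorm (derivToA Ω F ⟨sInf F, Nat.sInf_mem hF⟩ f) (z := ⟨z, hzΩ⟩) hzN

/-- The functions in `𝒜_F(Ω)` whose Taylor coefficients at `w` are `O(r⁻ⁿ)`. -/
def taylorBoundedSubmodule (F : Set ℕ) (w : Ω) (r : ℝ) (hr : 0 ≤ r) : Submodule ℂ (AF Ω F) where
  carrier := {f | TaylorBounded (f : Hol Ω) w r}
  add_mem' := by
    rintro f g ⟨M, hM⟩ ⟨N, hN⟩
    refine ⟨M + N, fun n => ?_⟩
    have h : ‖((D Ω ^ n) (f : Hol Ω) : Ω → ℂ) w + ((D Ω ^ n) (g : Hol Ω) : Ω → ℂ) w‖ * r ^ n ≤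
        (‖((D Ω ^ n) (f : Hol Ω) : Ω → ℂ) w‖ + ‖((D Ω ^ n) (g : Hol Ω) : Ω → ℂ) w‖) * r ^ n :=
      mul_le_mul_of_nonneg_right (norm_add_le _ _) (pow_nonneg hr n)
    simp only [Submodule.coe_add, map_add, Pi.add_apply]
    push_cast
    linarith [hM n, hN n]
  zero_mem' := ⟨0, fun n => by simp⟩
  smul_mem' := by
    rintro c f ⟨M, hM⟩
    obtain ⟨K, hK⟩ := exists_nat_ge ‖c‖
    refine ⟨K * M, fun n => ?_⟩
    have h := mul_le_mul hK (hM n) (mul_nonneg (norm_nonneg _) (pow_nonneg hr n))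
      (Nat.cast_nonneg K)
    simp only [Submodule.coe_smul, map_smul, Pi.smul_apply, norm_smul]
    push_cast
    linarith

theorem isClosed_setOf_taylor_le (hF : F.Nonempty) {b : ConnectedComponents Ω → Ω}
    (hb : ∀ c, ConnectedComponents.mk (b c) = c) (w : Ω) (r M : ℝ) :
    @IsClosed (AF Ω F) (naturalTopology Ω F b)
      {f | ∀ n : ℕ, ‖derivAt Ω F n w f‖ * r ^ n ≤ M * n.factorial} := by
  let _ : TopologicalSpace (AF Ω F) := naturalTopology Ω F b
  rw [Set.ofPred_forall]
  exact isClosed_iInter fun n => isClosed_le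
    ((continuous_derivAt hF hb n w).norm.mul continuous_const) continuous_const

/-- Discs with centre in `s` and rational radius that meet the complement of `Ω`. -/
def CrossingDisc (Ω : Opens ℂ) (s : Set Ω) : Type :=
  {p : s × ℚ // 0 < (p.2 : ℝ) ∧ (ball ((p.1 : Ω) : ℂ) p.2 ∩ (Ω : Set ℂ)ᶜ).Nonempty}

theorem nonExtendable_eq {s : Set Ω} (hs : Dense s) :
    nonExtendable Ω F = (⋃ p : CrossingDisc Ω s,
      (taylorBoundedSubmodule F (p.1.1 : Ω) p.1.2 p.2.1.le : Set (AF Ω F)))ᶜ := by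
  ext f
  rw [nonExtendable, ← Set.compl_ofPred, Set.mem_compl_iff, Set.mem_compl_iff, Set.mem_iUnion,
    Set.mem_ofPred_eq, not_iff_not]
  constructor
  · intro h
    obtain ⟨w, hw, r, hr, hne, ht⟩ := exists_taylorBounded_of_isExtendable hs h
    exact ⟨⟨(⟨w, hw⟩, r), hr, hne⟩, ht⟩
  · rintro ⟨p, hp⟩
    exact isExtendable_of_taylorBounded p.2.1 p.2.2 hp

theorem isGδ_compl_iUnion_taylorBoundedSubmodule (hF : F.Nonempty)
    {b : ConnectedComponents Ω → Ω} (hb : ∀ c, ConnectedComponents.mk (b c) = c)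
    (s : Set Ω) (hs : s.Countable) :
    @IsGδ (AF Ω F) (naturalTopology Ω F b) (⋃ p : CrossingDisc Ω s,
      (taylorBoundedSubmodule F (p.1.1 : Ω) p.1.2 p.2.1.le : Set (AF Ω F)))ᶜ := by
  let _ : TopologicalSpace (AF Ω F) := naturalTopology Ω F b
  have := hs.to_subtype
  have : Countable (CrossingDisc Ω s) := inferInstanceAs (Countable (Subtype _))
  -- Bounds `M` range over `ℕ`, so the intersection stays countable.
  have heq : (⋃ p : CrossingDisc Ω s,
      (taylorBoundedSubmodule F (p.1.1 : Ω) p.1.2 p.2.1.le : Set (AF Ω F)))ᶜ =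
      ⋂ p : CrossingDisc Ω s, ⋂ M : ℕ, {f | ∀ n : ℕ,
        ‖derivAt Ω F n p.1.1 f‖ * (p.1.2 : ℝ) ^ n ≤ (M : ℝ) * n.factorial}ᶜ := by
    rw [Set.compl_iUnion]
    refine Set.iInter_congr fun p => ?_
    rw [← Set.compl_iUnion]
    congr 1
    ext f
    rw [Set.mem_iUnion]
    exact Iff.rfl
  rw [heq]
  exact IsGδ.iInter fun p => IsGδ.iInter_of_isOpen fun M =>
    (isClosed_setOf_taylor_le hF hb _ _ _).isOpen_compl

end Natural

end NonExt

end

open NonExt in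
theorem theorem6p3 (Ω : TopologicalSpace.Opens ℂ) (F : Set ℕ) (hF : F.Nonempty)
    (b : ConnectedComponents Ω → Ω) (hb : ∀ c, ConnectedComponents.mk (b c) = c) :
    NonExt.nonExtendable Ω F = ∅ ∨
      (@Dense (NonExt.AF Ω F) (NonExt.naturalTopology Ω F b) (NonExt.nonExtendable Ω F) ∧
        @IsGδ (NonExt.AF Ω F) (NonExt.naturalTopology Ω F b) (NonExt.nonExtendable Ω F)) := by
  let _ : TopologicalSpace (AF Ω F) := naturalTopology Ω F b
  have hws : WithSeminorms (seminormFamily Ω F b) := ⟨rfl⟩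
  have := hws.topologicalAddGroup
  have := hws.continuousSMul
  obtain ⟨s, hsc, hs⟩ := TopologicalSpace.exists_countable_dense Ω
  have := hsc.to_subtype
  have : Countable (CrossingDisc Ω s) := inferInstanceAs (Countable (Subtype _))
  rcases (nonExtendable Ω F).eq_empty_or_nonempty with h | ⟨e, he⟩
  · exact Or.inl h
  refine Or.inr ?_
  have hV : ∀ p : CrossingDisc Ω s,
      e ∉ taylorBoundedSubmodule F (p.1.1 : Ω) p.1.2 p.2.1.le := by
    rw [nonExtendable_eq hs, Set.mem_compl_iff, Set.mem_iUnion, not_exists] at he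
    exact he
  rw [nonExtendable_eq hs]
  constructor
  · have : ContinuousAdd (AF Ω F) := hws.topologicalAddGroup.toContinuousAdd
    have hdense := dense_compl_iUnion_submodule (E := AF Ω F) (fun p : CrossingDisc Ω s =>
      taylorBoundedSubmodule F (p.1.1 : Ω) p.1.2 p.2.1.le) (e := e) hV
    exact hdense
  · exact isGδ_compl_iUnion_taylorBoundedSubmodule hF hb s hsc
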